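/- **Setting.** Fix a set of code call names $f$ (a package together with one of its functions), a non-empty linearly ordered set of objects, and variables $V_0,V_1,\dots$ A *term* is a variable or an object (constant). A *simple invariant expression* is an atomic code call condition $ie=\mathbf{in}(X,f(t_1,\dots,t_n))$, with terms $t_i$ and a bound main variable $X$; the variables of the $t_i$ are its base variables. A *state* $S$ is a set of ground atomic code call conditions, and for an assignment $\theta$ of objects to the variables $[ie]_{S,\theta}=\{o:\mathbf{in}(o,f(t_1\theta,\dots,t_n\theta))\in S\}$. An *invariant condition* is built by $\land,\lor$ from $true$, $false$ and atoms $t\;op\;t'$ with $op\in\{\le,\ge,<,>,=\}$. A *simple invariant* is $ic\Rightarrow ie\;\Re\;ie'$ with $\Re\in\{\subseteq,=\}$, where (except possibly in derived invariants) the variables of $ic$ are base variables of $ie$ or $ie'$. A state $S$ *satisfies* it if for every assignment $\theta$ that makes $ic$ true, $[ie]_{S,\theta}\,\Re\,[ie']_{S,\theta}$. A set of invariants *entails* an invariant if every state satisfying the whole set satisfies the invariant. $\mathrm{Taut}$ is the set of invariants satisfied in all states. Write $ie\to ie'$ if $[ie]_{S,\theta}\subseteq[ie']_{S,\theta}$ for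 all $S,\theta$, and $ic\to ic'$ if every assignment that makes $ic$ true makes $ic'$ true. Let $\mathbf{simplify}$ be any routine that returns $true$ on valid conditions, $false$ on inconsistent ones, and an equivalent condition otherwise. $\mathrm{ChkEnt}(inv_1,inv_2)$ holds if $ic_2\to ic_1$, $\Re_2$ is $\subseteq$ (and $\Re_1$ is $\subseteq$ or $=$), $ie_2\to ie_1$ and $ie_1'\to ie_2'$. For $inv_i: ic_i\Rightarrow ie_i\,\Re_i\,ie_i'$ and a set $X$ of invariants: * $\mathrm{Link}_X(e,e')$ means: $e\to e'$, or $X$ contains invariants $ic^{**}\Rightarrow e\subseteq e_1^*$, $ic^{*}\Rightarrow e_1^*\subseteq e_2^*$ and $ic^{***}\Rightarrow e_2^*\subseteq e'$ with $(ic_1\land ic_2)\to(ic^*\land ic^{**}\land ic^{***})$. * $\mathbf{Combine}_1(inv_1,inv_2,X)$ is $\mathbf{simplify}(ic_1\land ic_2)\Rightarrow ie_1\,\Re\,ie_2'$, where $\Re$ is $=$ if $\Re_1$ and $\Re_2$ are both $=$ and $\mathrm{Link}_X(ie_2,ie_1')$, and $\Re$ is $\subseteq$ otherwise. There is no result if $\mathrm{Link}_X(ie_1',ie_2)$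 fails, if the simplified condition is $false$, or if $\mathrm{ChkEnt}(inv,\cdot)$ holds between some $inv\in X$ and this invariant. * $\mathbf{Combine}_2(inv_1,inv_2)$: if $\Re_1$ and $\Re_2$ are both $\subseteq$, $\theta$ is a most general unifier of $ie_2,ie_1'$ and $\gamma$ one of $ie_2'\theta,ie_1\theta$, the result is $\mathbf{simplify}((ic_1\land ic_2)\theta\gamma)\Rightarrow ie_1\theta\gamma=ie_1'\theta\gamma$, unless the simplified condition is $false$. * $\mathbf{Combine}_3(inv_1,inv_2)$: if $\Re_1=\Re_2$, $\theta$ is a most general unifier of $ie_1,ie_2$ and $\gamma$ one of $ie_1'\theta,ie_2'\theta$, the result is $\mathbf{simplify}((ic_1\lor ic_2)\theta\gamma)\Rightarrow ie_1\theta\gamma\;\Re_1\;ie_1'\theta\gamma$. $\mathbf{Combine}_2$ and $\mathbf{Combine}_3$ have one result for each choice of the most general unifiers. Let $C_{\mathcal I}(X)$ consist of $\mathcal I\cup X$, all results $\mathbf{Combine}_1(inv_1,inv_2,X\cup\mathcal I)$, and all results of $\mathbf{Combine}_2(inv_1,inv_2)$ and $\mathbf{Combine}_3(inv_1,inv_2)$,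 for $inv_1,inv_2\in X\cup\mathcal I$. Let $C_{\mathcal I}\!\uparrow^0=\mathrm{Taut}$, $C_{\mathcal I}\!\uparrow^{i+1}=C_{\mathcal I}(C_{\mathcal I}\!\uparrow^i)$ and $C_{\mathcal I}\!\uparrow^\omega=\bigcup_{i\ge0}C_{\mathcal I}\!\uparrow^i$, where at each stage (including stage $0$) only the simple invariants with $\Re$ equal to $\subseteq$ are kept. **Theorem.** Let $\mathcal I$ be a finite set of simple invariants and $inv$ a simple invariant, all with $\Re$ equal to $\subseteq$. If $\mathcal I$ entails $inv$, then there is an invariant $inv'\in C_{\mathcal I}\!\uparrow^\omega$ such that $inv'$ entails $inv$. -/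

import Mathlib

/-!
Simple invariants between code calls, their semantics, and the operators that derive new invariants
from given ones. `F` is the type of code call names (a package together with one of its functions),
`Obj` is the linearly ordered type of objects. Variables are natural numbers.
-/

namespace CodeInv

universe u v

/-- A term: a variable or a constant (an object). -/
inductive Term (Obj : Type u) : Type u
  | var (n : ℕ) : Term Obj
  | const (o : Obj) : Term Obj

/-- An assignment of objects to variables. -/
abbrev Assignment (Obj : Type u) := ℕ → Obj

/-- A substitution of terms for variables. -/
abbrev Subst (Obj : Type u) := ℕ → Term Obj

namespace Term

variable {Obj : Type u}

def eval (θ : Assignment Obj) : Term Obj → Obj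
  | var n => θ n
  | const o => o

def subst (σ : Subst Obj) : Term Obj → Term Obj
  | var n => σ n
  | const o => const o

def vars : Term Obj → Set ℕ
  | var n => {n}
  | const _ => ∅

end Term

/-- `θ.comp γ` is the substitution "first `θ`, then `γ`", written `θγ` in postfix notation. -/
def Subst.comp {Obj : Type u} (θ γ : Subst Obj) : Subst Obj := fun n => (θ n).subst γ

/-- The comparison symbols of invariant condition atoms. -/
inductive Op
  | le | ge | lt | gt | eq

def Op.holds {Obj : Type u} [LinearOrder Obj] : Op → Obj → Obj → Prop
  | le, a, b => a ≤ b
  | ge, a, b => a ≥ b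
  | lt, a, b => a < b
  | gt, a, b => a > b
  | eq, a, b => a = b

/-- Invariant conditions: built from comparison atoms by conjunction and disjunction, together with
the two conditions `true` and `false`. -/
inductive Cond (Obj : Type u) : Type u
  | tru : Cond Obj
  | fls : Cond Obj
  | atom (t₁ : Term Obj) (op : Op) (t₂ : Term Obj) : Cond Obj
  | and (c₁ c₂ : Cond Obj) : Cond Obj
  | or (c₁ c₂ : Cond Obj) : Cond Obj

namespace Cond

variable {Obj : Type u}

def holds [LinearOrder Obj] (θ : Assignment Obj) : Cond Obj → Prop
  | tru => True
  | fls => False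
  | atom t₁ op t₂ => op.holds (t₁.eval θ) (t₂.eval θ)
  | and c₁ c₂ => c₁.holds θ ∧ c₂.holds θ
  | or c₁ c₂ => c₁.holds θ ∨ c₂.holds θ

def subst (σ : Subst Obj) : Cond Obj → Cond Obj
  | tru => tru
  | fls => fls
  | atom t₁ op t₂ => atom (t₁.subst σ) op (t₂.subst σ)
  | and c₁ c₂ => and (c₁.subst σ) (c₂.subst σ)
  | or c₁ c₂ => or (c₁.subst σ) (c₂.subst σ)

def vars : Cond Obj → Set ℕ
  | tru => ∅
  | fls => ∅
  | atom t₁ _ t₂ => t₁.vars ∪ t₂.vars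
  | and c₁ c₂ => c₁.vars ∪ c₂.vars
  | or c₁ c₂ => c₁.vars ∪ c₂.vars

end Cond

/-- A simple invariant expression, that is an atomic code call condition `in(X, f(args))`. The main
variable `X` is bound by the denotation below and is therefore left nameless; the variables
occurring in `args` are the base variables. -/
structure Expr (F : Type v) (Obj : Type u) where
  fn : F
  args : List (Term Obj)

/-- A state: the set of ground atomic code call conditions that are true in it. That `(f, a, o)`
belongs to the state means that `in(o, f(a))` is true: the object `o` is in the answer to `f(a)`. -/
abbrev State (F : Type v) (Obj : Type u) := Set (F × List Obj × Obj)

namespace Expr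

variable {F : Type v} {Obj : Type u}

/-- The set of objects denoted by the expression. -/
def denot (S : State F Obj) (θ : Assignment Obj) (e : Expr F Obj) : Set Obj :=
  {o | (e.fn, e.args.map (Term.eval θ), o) ∈ S}

def subst (σ : Subst Obj) (e : Expr F Obj) : Expr F Obj := ⟨e.fn, e.args.map (Term.subst σ)⟩

def vars (e : Expr F Obj) : Set ℕ := {n | ∃ t ∈ e.args, n ∈ t.vars}

/-- The implication `e₁ → e₂` between expressions: inclusion in all states, for all assignments. -/
def Implies (e₁ e₂ : Expr F Obj) : Prop :=
  ∀ (S : State F Obj) (θ : Assignment Obj), e₁.denot S θ ⊆ e₂.denot S θ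

end Expr

/-- `θ` is a most general unifier of `e₁` and `e₂`. -/
def IsMGU {F : Type v} {Obj : Type u} (θ : Subst Obj) (e₁ e₂ : Expr F Obj) : Prop :=
  e₁.subst θ = e₂.subst θ ∧
    ∀ σ : Subst Obj, e₁.subst σ = e₂.subst σ → ∃ δ : Subst Obj, σ = θ.comp δ

/-- The relation symbol of an invariant: `⊆` or `=`. -/
inductive Rel
  | sub | eq

/-- A simple invariant `ic ⟹ lhs ℜ rhs`. -/
structure Inv (F : Type v) (Obj : Type u) where
  ic : Cond Obj
  lhs : Expr F Obj
  rel : Rel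
  rhs : Expr F Obj

def Rel.holds {Obj : Type u} : Rel → Set Obj → Set Obj → Prop
  | sub, A, B => A ⊆ B
  | eq, A, B => A = B

section

variable {F : Type v} {Obj : Type u}

/-- Every variable of the condition is a base variable of one of the two expressions. -/
def Inv.WellFormed (J : Inv F Obj) : Prop := J.ic.vars ⊆ J.lhs.vars ∪ J.rhs.vars

variable [LinearOrder Obj]

/-- Satisfaction of an invariant in a state: all ground instances of the invariant are true. -/
def Inv.Sat (S : State F Obj) (J : Inv F Obj) : Prop :=
  ∀ θ : Assignment Obj, J.ic.holds θ → J.rel.holds (J.lhs.denot S θ) (J.rhs.denot S θ)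

/-- Entailment of an invariant by a set of invariants. -/
def Entails (I : Set (Inv F Obj)) (J : Inv F Obj) : Prop :=
  ∀ S : State F Obj, (∀ K ∈ I, K.Sat S) → J.Sat S

/-- The tautologies: the invariants that are satisfied in all states. -/
def Taut : Set (Inv F Obj) := {J | J.WellFormed ∧ ∀ S : State F Obj, J.Sat S}

/-- The specification of the routine `simplify`: valid conditions become `true`, inconsistent ones
become `false`, and every other condition becomes some equivalent one. -/
structure IsSimplify (simplify : Cond Obj → Cond Obj) : Prop where
  valid : ∀ c, (∀ θ, c.holds θ) → simplify c = .tru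
  inconsistent : ∀ c, (∀ θ, ¬ c.holds θ) → simplify c = .fls
  equiv : ∀ c, (¬ ∀ θ, c.holds θ) → (¬ ∀ θ, ¬ c.holds θ) →
    ∀ θ, (simplify c).holds θ ↔ c.holds θ

/-- The syntactic, sound (but incomplete) check that `J₁` entails `J₂`. -/
def ChkEnt (J₁ J₂ : Inv F Obj) : Prop :=
  (∀ θ, J₂.ic.holds θ → J₁.ic.holds θ) ∧
  ((J₁.rel = .sub ∧ J₂.rel = .sub) ∨ (J₁.rel = .eq ∧ J₂.rel = .sub)) ∧
  J₂.lhs.Implies J₁.lhs ∧ J₁.rhs.Implies J₂.rhs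

/-- `X` contains `ic** ⟹ e ⊆ e₁*`, `ic* ⟹ e₁* ⊆ e₂*` and `ic*** ⟹ e₂* ⊆ e'` such that `c` implies
`ic* ∧ ic** ∧ ic***`. -/
def Chain (X : Set (Inv F Obj)) (c : Cond Obj) (e e' : Expr F Obj) : Prop :=
  ∃ (c₁ c₂ c₃ : Cond Obj) (e₁ e₂ : Expr F Obj),
    ⟨c₁, e₁, .sub, e₂⟩ ∈ X ∧ ⟨c₂, e, .sub, e₁⟩ ∈ X ∧ ⟨c₃, e₂, .sub, e'⟩ ∈ X ∧
    ∀ θ, c.holds θ → c₁.holds θ ∧ c₂.holds θ ∧ c₃.holds θ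

open Classical in
/-- The relation symbol of the invariant derived by `Combine_1(J₁, J₂, X)`. -/
noncomputable def derivedRel (J₁ J₂ : Inv F Obj) (X : Set (Inv F Obj)) : Rel :=
  if J₁.rel = .eq ∧ J₂.rel = .eq ∧
    (J₂.lhs.Implies J₁.rhs ∨ Chain X (J₁.ic.and J₂.ic) J₂.lhs J₁.rhs)
  then .eq else .sub

/-- The invariant derived by `Combine_1(J₁, J₂, X)` if the algorithm does not return NIL. -/
noncomputable def derivedInv (simplify : Cond Obj → Cond Obj) (J₁ J₂ : Inv F Obj)
    (X : Set (Inv F Obj)) : Inv F Obj :=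
  ⟨simplify (J₁.ic.and J₂.ic), J₁.lhs, derivedRel J₁ J₂ X, J₂.rhs⟩

open Classical in
/-- `Combine_1(J₁, J₂, X)`; the value `none` is NIL. -/
noncomputable def combine₁ (simplify : Cond Obj → Cond Obj) (J₁ J₂ : Inv F Obj)
    (X : Set (Inv F Obj)) : Option (Inv F Obj) :=
  if ¬ J₁.rhs.Implies J₂.lhs ∧ ¬ Chain X (J₁.ic.and J₂.ic) J₁.rhs J₂.lhs then none
  else if simplify (J₁.ic.and J₂.ic) = .fls then none
  else if ∃ J ∈ X, ChkEnt J (derivedInv simplify J₁ J₂ X) then none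
  else some (derivedInv simplify J₁ J₂ X)

/-- The possible results of `Combine_2(J₁, J₂)`. There is one result for each choice of the most
general unifiers, and no result if the algorithm returns NIL. The second unifier is computed after
the first one has been applied, so that `θγ` unifies both pairs of expressions. -/
def combine₂ (simplify : Cond Obj → Cond Obj) (J₁ J₂ : Inv F Obj) : Set (Inv F Obj) :=
  {K | J₁.rel = .sub ∧ J₂.rel = .sub ∧ ∃ θ γ : Subst Obj,
    IsMGU θ J₂.lhs J₁.rhs ∧ IsMGU γ (J₂.rhs.subst θ) (J₁.lhs.subst θ) ∧
    simplify ((J₁.ic.and J₂.ic).subst (θ.comp γ)) ≠ .fls ∧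
    K = ⟨simplify ((J₁.ic.and J₂.ic).subst (θ.comp γ)),
      J₁.lhs.subst (θ.comp γ), .eq, J₁.rhs.subst (θ.comp γ)⟩}

/-- The possible results of `Combine_3(J₁, J₂)`, one for each choice of the most general
unifiers. -/
def combine₃ (simplify : Cond Obj → Cond Obj) (J₁ J₂ : Inv F Obj) : Set (Inv F Obj) :=
  {K | J₁.rel = J₂.rel ∧ ∃ θ γ : Subst Obj,
    IsMGU θ J₁.lhs J₂.lhs ∧ IsMGU γ (J₁.rhs.subst θ) (J₂.rhs.subst θ) ∧
    K = ⟨simplify ((J₁.ic.or J₂.ic).subst (θ.comp γ)),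
      J₁.lhs.subst (θ.comp γ), J₁.rel, J₁.rhs.subst (θ.comp γ)⟩}

/-- The operator `C_I`. -/
def C (simplify : Cond Obj → Cond Obj) (I X : Set (Inv F Obj)) : Set (Inv F Obj) :=
  {K | ∃ J₁ ∈ X ∪ I, ∃ J₂ ∈ X ∪ I, combine₁ simplify J₁ J₂ (X ∪ I) = some K} ∪
  {K | ∃ J₁ ∈ X ∪ I, ∃ J₂ ∈ X ∪ I, K ∈ combine₂ simplify J₁ J₂} ∪
  {K | ∃ J₁ ∈ X ∪ I, ∃ J₂ ∈ X ∪ I, K ∈ combine₃ simplify J₁ J₂} ∪ I ∪ X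

/-- The powers `C_I ↑ n` inside a class `U` of invariants to which one restricts attention. -/
def Cpow (simplify : Cond Obj → Cond Obj) (U I : Set (Inv F Obj)) : ℕ → Set (Inv F Obj)
  | 0 => Taut ∩ U
  | n + 1 => C simplify I (Cpow simplify U I n) ∩ U

/-- The set `C_I ↑ ω` inside the class `U`. -/
def Comega (simplify : Cond Obj → Cond Obj) (U I : Set (Inv F Obj)) : Set (Inv F Obj) :=
  ⋃ n, Cpow simplify U I n

end

/-- The class of the simple invariants whose relation is `⊆`. -/
def SubInv (F : Type v) (Obj : Type u) : Set (Inv F Obj) := {J | J.rel = .sub}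

end CodeInv

/-!
An entailment `I ⊨ (ic ⟹ e ⊆ e')` says that for every assignment `θ` with `ic` the ground expression
`eθ` is joined to `e'θ` by a finite path of ground instances of invariants of `I`: otherwise the
state consisting of everything reachable from `eθ` would be a countermodel.

*One path.* The operators can follow such a path symbolically. `combine₃ J J` renames the variables
of `J`, because every injective renaming is a most general unifier of an expression with itself; the
tautologies `t₁ = t₁' ∧ … ⟹ f(t₁, …) ⊆ f(t₁', …)` connect one expression with the next; and
`combine₁` composes. When `combine₁` returns nothing because of `ChkEnt`, an at least equally strong
invariant is already present, so everything is phrased for `Derivable`, which means derivability up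
to `ChkEnt`. The path thus yields a derivable `φ ⟹ e ⊆ e'`, where `φ` may have auxiliary variables
and holds under an assignment extending `θ` (`exists_derivable_of_reach`).

*Finitely many paths suffice.* The lengths of the paths are not bounded a priori, since `Obj` is
an arbitrary linear order. Take the finitely many values that occur along the path of `θ`, in
increasing order, and label each with the set of those terms (from a fixed finite list containing
the relevant variables and constants) whose value it is. This is a word over a finite alphabet. If
the word of `θ` is a subword of the word of `θ'`, then there is a strictly monotone map from the
values of `θ` to those of `θ'` that respects the labels, and it carries the witness for the path
condition of `θ` to one for `θ'`, because conditions only compare values. By Higman's lemma finitely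
many words, hence finitely many path conditions, take care of all assignments
(`exists_finset_sublist`, `exists_strictMonoOn_of_sublist`). Their disjunction, formed with
`combine₃`, is the condition of the invariant sought.
-/

namespace CodeInv

universe u v

/-! ### Terms, conditions and substitutions -/

section Terms

variable {F : Type v} {Obj : Type u}

/-- The terms occurring in the atoms of a condition. -/
def Cond.terms : Cond Obj → List (Term Obj)
  | .tru => []
  | .fls => []
  | .atom t₁ _ t₂ => [t₁, t₂]
  | .and c₁ c₂ => c₁.terms ++ c₂.terms
  | .or c₁ c₂ => c₁.terms ++ c₂.terms

/-- The terms occurring in an invariant. -/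
def Inv.terms (J : Inv F Obj) : List (Term Obj) := J.ic.terms ++ J.lhs.args ++ J.rhs.args

/-- The conjunction of the equations between corresponding entries of two lists of terms. Surplus
entries of the longer list are ignored. -/
def eqCond : List (Term Obj) → List (Term Obj) → Cond Obj
  | t :: l, t' :: l' => .and (.atom t .eq t') (eqCond l l')
  | _, _ => .tru

/-- The ground expression obtained from `e` by applying an assignment. -/
def Expr.ground (θ : Assignment Obj) (e : Expr F Obj) : F × List Obj :=
  (e.fn, e.args.map (Term.eval θ))

/-- The renaming of variables that adds `N` to every index. -/
def shift (N : ℕ) : Subst Obj := fun n => .var (n + N)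

@[simp] lemma Term.subst_var (t : Term Obj) : t.subst Term.var = t := by cases t <;> rfl

@[simp] lemma Cond.subst_var (c : Cond Obj) : c.subst Term.var = c := by
  induction c <;> simp_all [Cond.subst]

@[simp] lemma Expr.subst_var (e : Expr F Obj) : e.subst Term.var = e := by
  have : Term.subst (Obj := Obj) Term.var = id := funext Term.subst_var
  simp [Expr.subst, this]

@[simp] lemma Subst.comp_var (θ : Subst Obj) : θ.comp Term.var = θ := by
  funext n; simp [Subst.comp]

lemma Subst.var_comp (σ : Subst Obj) : Subst.comp Term.var σ = σ := rfl

lemma isMGU_self_var (e : Expr F Obj) : IsMGU Term.var e e :=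
  ⟨rfl, fun σ _ => ⟨σ, (Subst.var_comp σ).symm⟩⟩

lemma isMGU_self_shift (N : ℕ) (e : Expr F Obj) : IsMGU (shift N) e e :=
  ⟨rfl, fun σ _ => ⟨fun n => σ (n - N), by funext n; simp [Subst.comp, shift, Term.subst]⟩⟩

lemma Term.eval_subst_shift {N : ℕ} {η τ : Assignment Obj} (h : ∀ n, η (n + N) = τ n)
    (t : Term Obj) : (t.subst (shift N)).eval η = t.eval τ := by
  cases t <;> simp [Term.subst, Term.eval, shift, h]

lemma Cond.terms_subst (σ : Subst Obj) (c : Cond Obj) :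
    (c.subst σ).terms = c.terms.map (Term.subst σ) := by
  induction c <;> simp_all [Cond.subst, Cond.terms]

lemma Expr.ground_subst_shift {N : ℕ} {η τ : Assignment Obj} (h : ∀ n, η (n + N) = τ n)
    (e : Expr F Obj) : (e.subst (shift N)).ground η = e.ground τ := by
  simp [Expr.ground, Expr.subst, Term.eval_subst_shift h]

lemma Term.eval_congr {N : ℕ} {η η' : Assignment Obj} (h : ∀ n < N, η' n = η n) {t : Term Obj}
    (ht : ∀ n, t = .var n → n < N) : t.eval η' = t.eval η := by
  cases t with
  | var n => exact h n (ht n rfl)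
  | const o => rfl

lemma Expr.ground_congr {N : ℕ} {η η' : Assignment Obj} (h : ∀ n < N, η' n = η n) {e : Expr F Obj}
    (he : ∀ n, Term.var n ∈ e.args → n < N) : e.ground η' = e.ground η := by
  simp only [Expr.ground, Prod.mk.injEq, true_and]
  exact List.map_congr_left fun t ht => Term.eval_congr h fun n hn => he n (hn ▸ ht)

lemma exists_var_bound (l : List (Term Obj)) : ∃ N, ∀ n, Term.var n ∈ l → n < N := by
  induction l with
  | nil => exact ⟨0, by simp⟩
  | cons t l ih =>
    obtain ⟨N, hN⟩ := ih
    cases t with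
    | const o => exact ⟨N, fun n hn => hN n (by simpa using hn)⟩
    | var k =>
      refine ⟨max N (k + 1), fun n hn => ?_⟩
      simp only [List.mem_cons, Term.var.injEq] at hn
      rcases hn with rfl | hn
      · omega
      · exact lt_of_lt_of_le (hN n hn) (le_max_left _ _)

lemma vars_eqCond (l l' : List (Term Obj)) :
    (eqCond l l').vars ⊆ {n | ∃ t ∈ l, n ∈ t.vars} ∪ {n | ∃ t ∈ l', n ∈ t.vars} := by
  induction l generalizing l' with
  | nil => simp [eqCond, Cond.vars]
  | cons t l ih =>
    cases l' with
    | nil => simp [eqCond, Cond.vars]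
    | cons t' l' =>
      intro n hn
      rcases hn with (hn | hn) | hn
      · exact .inl ⟨t, by simp, hn⟩
      · exact .inr ⟨t', by simp, hn⟩
      · rcases ih l' hn with ⟨s, hs, h⟩ | ⟨s, hs, h⟩
        · exact .inl ⟨s, by simp [hs], h⟩
        · exact .inr ⟨s, by simp [hs], h⟩

lemma mem_of_mem_terms_eqCond {l l' : List (Term Obj)} {t : Term Obj}
    (ht : t ∈ (eqCond l l').terms) : t ∈ l ∨ t ∈ l' := by
  induction l generalizing l' with
  | nil => simp [eqCond, Cond.terms] at ht
  | cons s l ih =>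
    cases l' with
    | nil => simp [eqCond, Cond.terms] at ht
    | cons s' l' =>
      simp only [eqCond, Cond.terms, List.cons_append, List.nil_append, List.mem_cons] at ht ⊢
      rcases ht with h | h | h
      · exact .inl (.inl h)
      · exact .inr (.inl h)
      · exact (ih h).imp .inr .inr

/-! ### Implication between expressions -/

lemma Expr.implies_rfl (e : Expr F Obj) : e.Implies e := fun _ _ => subset_rfl

lemma Expr.Implies.trans {e₁ e₂ e₃ : Expr F Obj} (h : e₁.Implies e₂) (h' : e₂.Implies e₃) :
    e₁.Implies e₃ := fun S θ => (h S θ).trans (h' S θ)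

lemma Term.ext_eval [Nontrivial Obj] {t t' : Term Obj} (h : ∀ θ, t.eval θ = t'.eval θ) :
    t = t' := by
  classical
  have key (n : ℕ) (s : Term Obj) (hs : ∀ θ, (Term.var n).eval θ = s.eval θ) : Term.var n = s := by
    obtain ⟨a, b, hab⟩ := exists_pair_ne Obj
    cases s with
    | var m =>
      by_contra hne
      have hnm : m ≠ n := fun h => hne (h ▸ rfl)
      have := hs fun k => if k = n then a else b
      simp [Term.eval, hnm, hab] at this
    | const o => exact absurd ((hs fun _ => a).trans (hs fun _ => b).symm) hab
  cases t with
  | var n => exact key n t' h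
  | const o =>
    cases t' with
    | var m => exact (key m _ fun θ => (h θ).symm).symm
    | const o' =>
      obtain ⟨a, -⟩ := exists_pair_ne Obj
      exact congrArg _ (h fun _ => a)

/-- With at least two objects, implication between expressions is syntactic equality. -/
lemma Expr.Implies.eq [Nontrivial Obj] {e₁ e₂ : Expr F Obj} (h : e₁.Implies e₂) : e₁ = e₂ := by
  obtain ⟨f₁, l₁⟩ := e₁
  obtain ⟨f₂, l₂⟩ := e₂
  have key (θ : Assignment Obj) : f₂ = f₁ ∧ l₂.map (Term.eval θ) = l₁.map (Term.eval θ) := by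
    have := h {(f₁, l₁.map (Term.eval θ), θ 0)} θ (a := θ 0) rfl
    simpa [Expr.denot] using this
  obtain ⟨a, -⟩ := exists_pair_ne Obj
  obtain rfl := (key fun _ => a).1
  have hl (θ : Assignment Obj) := (key θ).2
  congr 1
  clear h key
  induction l₁ generalizing l₂ with
  | nil => simpa using (hl fun _ => a).symm
  | cons t l₁ ih =>
    cases l₂ with
    | nil => simpa using hl fun _ => a
    | cons t' l₂ =>
      simp only [List.map_cons, List.cons.injEq] at hl
      rw [Term.ext_eval fun θ => (hl θ).1, ih l₂ fun θ => (hl θ).2]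

/-! ### Truth of conditions -/

variable [LinearOrder Obj]

lemma holds_eqCond {l l' : List (Term Obj)} (hl : l.length = l'.length) (θ : Assignment Obj) :
    (eqCond l l').holds θ ↔ l.map (Term.eval θ) = l'.map (Term.eval θ) := by
  induction l generalizing l' with
  | nil => cases l' <;> simp_all [eqCond, Cond.holds]
  | cons t l ih =>
    cases l' with
    | nil => simp at hl
    | cons t' l' => simp [eqCond, Cond.holds, Op.holds, ih (Nat.succ.inj hl)]

/-- Conditions only compare values, so a strictly monotone map of values preserves them. -/
lemma Cond.holds_of_strictMonoOn {c : Cond Obj} {s : Set Obj} {h : Obj → Obj}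
    (hs : StrictMonoOn h s) {η η' : Assignment Obj} (hmem : ∀ t ∈ c.terms, t.eval η ∈ s)
    (heval : ∀ t ∈ c.terms, t.eval η' = h (t.eval η)) : c.holds η → c.holds η' := by
  induction c with
  | tru => exact id
  | fls => exact id
  | atom t₁ op t₂ =>
    have m₁ := hmem t₁ (by simp [terms])
    have m₂ := hmem t₂ (by simp [terms])
    simp only [holds, heval t₁ (by simp [terms]), heval t₂ (by simp [terms])]
    cases op
    · exact (hs.le_iff_le m₁ m₂).2
    · exact (hs.le_iff_le m₂ m₁).2
    · exact (hs.lt_iff_lt m₁ m₂).2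
    · exact (hs.lt_iff_lt m₂ m₁).2
    · exact congrArg h
  | and c₁ c₂ ih₁ ih₂ =>
    simp only [terms, List.mem_append] at hmem heval
    exact And.imp (ih₁ (fun t ht => hmem t (.inl ht)) fun t ht => heval t (.inl ht))
      (ih₂ (fun t ht => hmem t (.inr ht)) fun t ht => heval t (.inr ht))
  | or c₁ c₂ ih₁ ih₂ =>
    simp only [terms, List.mem_append] at hmem heval
    exact Or.imp (ih₁ (fun t ht => hmem t (.inl ht)) fun t ht => heval t (.inl ht))
      (ih₂ (fun t ht => hmem t (.inr ht)) fun t ht => heval t (.inr ht))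

lemma Cond.holds_congr {N : ℕ} {η η' : Assignment Obj} (h : ∀ n < N, η' n = η n) {c : Cond Obj}
    (hc : ∀ n, Term.var n ∈ c.terms → n < N) : c.holds η → c.holds η' :=
  Cond.holds_of_strictMonoOn (s := Set.univ) (h := id) (strictMono_id.strictMonoOn _)
    (fun _ _ => trivial) fun _ ht => Term.eval_congr h fun n hn => hc n (hn ▸ ht)

lemma Cond.holds_subst_shift {N : ℕ} {η τ : Assignment Obj} (h : ∀ n, η (n + N) = τ n)
    (c : Cond Obj) : (c.subst (shift N)).holds η ↔ c.holds τ := by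
  induction c <;> simp_all [Cond.subst, Cond.holds, Term.eval_subst_shift h]

lemma IsSimplify.holds_iff {simplify : Cond Obj → Cond Obj} (hs : IsSimplify simplify)
    (c : Cond Obj) (θ : Assignment Obj) : (simplify c).holds θ ↔ c.holds θ := by
  by_cases h₁ : ∀ θ, c.holds θ
  · simp [hs.valid c h₁, Cond.holds, h₁ θ]
  by_cases h₂ : ∀ θ, ¬ c.holds θ
  · simp [hs.inconsistent c h₂, Cond.holds, h₂ θ]
  exact hs.equiv c h₁ h₂ θ

end Terms

/-! ### Derivability -/

section Derivable

variable {F : Type v} {Obj : Type u} [LinearOrder Obj] {simplify : Cond Obj → Cond Obj}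
  {I : Set (Inv F Obj)}

/-- `c ⟹ e ⊆ e'` is derivable if `C_I ↑ ω` has an element from which it follows by the syntactic
check `ChkEnt`. -/
def Derivable (simplify : Cond Obj → Cond Obj) (I : Set (Inv F Obj)) (c : Cond Obj)
    (e e' : Expr F Obj) : Prop :=
  ∃ K ∈ Comega simplify (SubInv F Obj) I, ChkEnt K ⟨c, e, .sub, e'⟩

lemma Cpow_mono {U : Set (Inv F Obj)} : Monotone (Cpow simplify U I) := by
  refine monotone_nat_of_le_succ fun n J hJ => ⟨.inr hJ, ?_⟩
  cases n with
  | zero => exact hJ.2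
  | succ n => exact hJ.2

lemma rel_of_mem_Comega {K : Inv F Obj} (hK : K ∈ Comega simplify (SubInv F Obj) I) :
    K.rel = .sub := by
  obtain ⟨n, hn⟩ := Set.mem_iUnion.1 hK
  cases n with
  | zero => exact hn.2
  | succ n => exact hn.2

lemma exists_mem_Cpow {U : Set (Inv F Obj)} {K₁ K₂ : Inv F Obj}
    (h₁ : K₁ ∈ Comega simplify U I) (h₂ : K₂ ∈ Comega simplify U I) :
    ∃ n, K₁ ∈ Cpow simplify U I n ∧ K₂ ∈ Cpow simplify U I n := by
  obtain ⟨m, hm⟩ := Set.mem_iUnion.1 h₁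
  obtain ⟨n, hn⟩ := Set.mem_iUnion.1 h₂
  exact ⟨max m n, Cpow_mono (le_max_left _ _) hm, Cpow_mono (le_max_right _ _) hn⟩

lemma Derivable.of_mem {K : Inv F Obj} (hK : K ∈ Comega simplify (SubInv F Obj) I)
    {c : Cond Obj} (hc : ∀ θ, c.holds θ → K.ic.holds θ) : Derivable simplify I c K.lhs K.rhs :=
  ⟨K, hK, hc, .inl ⟨rel_of_mem_Comega hK, rfl⟩, K.lhs.implies_rfl, K.rhs.implies_rfl⟩

lemma mem_Comega_of_taut {K : Inv F Obj} (hK : K ∈ Taut) (hrel : K.rel = .sub) :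
    K ∈ Comega simplify (SubInv F Obj) I :=
  Set.mem_iUnion.2 ⟨0, hK, hrel⟩

lemma mem_Comega_of_combine₃ {K₁ K₂ K : Inv F Obj}
    (h₁ : K₁ ∈ Comega simplify (SubInv F Obj) I) (h₂ : K₂ ∈ Comega simplify (SubInv F Obj) I)
    (hK : K ∈ combine₃ simplify K₁ K₂) : K ∈ Comega simplify (SubInv F Obj) I := by
  obtain ⟨n, h₁n, h₂n⟩ := exists_mem_Cpow h₁ h₂
  refine Set.mem_iUnion.2 ⟨n + 1, .inl (.inl (.inr ⟨K₁, .inl h₁n, K₂, .inl h₂n, hK⟩)), ?_⟩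
  obtain ⟨-, θ, γ, -, -, rfl⟩ := hK
  exact (rel_of_mem_Comega h₁ : K₁.rel = .sub)

lemma mem_Comega_of_mem {J : Inv F Obj} (hJ : J ∈ I) (hrel : J.rel = .sub) :
    J ∈ Comega simplify (SubInv F Obj) I :=
  Set.mem_iUnion.2 ⟨1, .inl (.inr hJ), hrel⟩

/-- The tautologies provide a link between any two expressions of the same shape. -/
lemma derivable_eqCond (f : F) {l l' : List (Term Obj)} (hl : l.length = l'.length) :
    Derivable simplify I (eqCond l l') ⟨f, l⟩ ⟨f, l'⟩ := by
  refine .of_mem (K := ⟨eqCond l l', ⟨f, l⟩, .sub, ⟨f, l'⟩⟩) (mem_Comega_of_taut ⟨?_, ?_⟩ rfl)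
    fun _ => id
  · exact vars_eqCond l l'
  · intro S θ h o ho
    have h := (holds_eqCond hl θ).1 h
    simpa [Expr.denot, h] using ho

lemma derivable_refl (e : Expr F Obj) : Derivable simplify I .tru e e :=
  .of_mem (K := ⟨.tru, e, .sub, e⟩)
    (mem_Comega_of_taut ⟨Set.empty_subset _, fun _ _ _ => subset_rfl⟩ rfl) fun _ => id

/-- Renaming by `combine₃`: combining an invariant with itself, with the renaming as first most
general unifier. -/
lemma derivable_shift (hs : IsSimplify simplify) {J : Inv F Obj} (hJ : J ∈ I)
    (hrel : J.rel = .sub) (N : ℕ) :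
    Derivable simplify I (J.ic.subst (shift N)) (J.lhs.subst (shift N))
      (J.rhs.subst (shift N)) := by
  have hJ' : J ∈ Comega simplify (SubInv F Obj) I := mem_Comega_of_mem hJ hrel
  have := mem_Comega_of_combine₃ hJ' hJ' ⟨rfl, shift N, Term.var, isMGU_self_shift N _,
    isMGU_self_var _, rfl⟩
  rw [Subst.comp_var] at this
  refine Derivable.of_mem this fun θ h => (hs.holds_iff _ _).2 ?_
  exact .inl h

/-- Composition by `combine₁`. The consistency of the combined condition keeps `combine₁` from
returning nothing for that reason; if it returns nothing because of `ChkEnt`, then the invariant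
found by the check serves instead. -/
lemma Derivable.trans (hs : IsSimplify simplify) {c₁ c₂ : Cond Obj} {e₁ e₂ e₃ : Expr F Obj}
    (h₁ : Derivable simplify I c₁ e₁ e₂) (h₂ : Derivable simplify I c₂ e₂ e₃)
    (hI : ∀ J ∈ I, J.rel = .sub) (hcons : ∃ θ, c₁.holds θ ∧ c₂.holds θ) :
    Derivable simplify I (c₁.and c₂) e₁ e₃ := by
  obtain ⟨K₁, hK₁, hc₁, -, hl₁, hr₁⟩ := h₁
  obtain ⟨K₂, hK₂, hc₂, -, hl₂, hr₂⟩ := h₂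
  obtain ⟨θ₀, hθ₁, hθ₂⟩ := hcons
  obtain ⟨n, hn₁, hn₂⟩ := exists_mem_Cpow hK₁ hK₂
  set X := Cpow simplify (SubInv F Obj) I n ∪ I with hX
  have hc : ∀ θ, (c₁.and c₂).holds θ → (simplify (K₁.ic.and K₂.ic)).holds θ := fun θ h =>
    (hs.holds_iff _ _).2 ⟨hc₁ θ h.1, hc₂ θ h.2⟩
  have hlink : K₁.rhs.Implies K₂.lhs := hr₁.trans hl₂
  have hne : simplify (K₁.ic.and K₂.ic) ≠ .fls := fun h => by
    simpa [h, Cond.holds] using hc θ₀ ⟨hθ₁, hθ₂⟩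
  have hrel : derivedRel K₁ K₂ X = .sub := by simp [derivedRel, rel_of_mem_Comega hK₁]
  by_cases hchk : ∃ J ∈ X, ChkEnt J (derivedInv simplify K₁ K₂ X)
  · obtain ⟨J, hJ, hJc, -, hJl, hJr⟩ := hchk
    have hJ' : J ∈ Comega simplify (SubInv F Obj) I := by
      rcases hJ with hJ | hJ
      · exact Set.mem_iUnion.2 ⟨n, hJ⟩
      · exact mem_Comega_of_mem hJ (hI J hJ)
    exact ⟨J, hJ', fun θ h => hJc θ (hc θ h), .inl ⟨rel_of_mem_Comega hJ', rfl⟩,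
      hl₁.trans hJl, hJr.trans hr₂⟩
  · have hcomb : combine₁ simplify K₁ K₂ X = some (derivedInv simplify K₁ K₂ X) := by
      simp only [combine₁, hlink, hne, hchk, not_true_eq_false, false_and, if_false]
    refine ⟨derivedInv simplify K₁ K₂ X, Set.mem_iUnion.2 ⟨n + 1, ?_, hrel⟩, hc,
      .inl ⟨hrel, rfl⟩, hl₁, hr₂⟩
    exact .inl (.inl (.inl (.inl ⟨K₁, .inl hn₁, K₂, .inl hn₂, hcomb⟩)))

/-- Disjunction by `combine₃`. -/
lemma Derivable.or (hs : IsSimplify simplify) {c₁ c₂ : Cond Obj} {e e' : Expr F Obj}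
    (h₁ : Derivable simplify I c₁ e e') (h₂ : Derivable simplify I c₂ e e') :
    Derivable simplify I (c₁.or c₂) e e' := by
  rcases subsingleton_or_nontrivial Obj with hO | hO
  · -- With a single object expressions that imply each other need not be unifiable, but a condition
    -- is either valid or inconsistent, and one of the two invariants is good enough.
    by_cases h : ∃ θ, c₁.holds θ
    · obtain ⟨θ₀, hθ₀⟩ := h
      obtain ⟨K, hK, hc, hrest⟩ := h₁
      exact ⟨K, hK, fun θ _ => hc θ (Subsingleton.elim θ₀ θ ▸ hθ₀), hrest⟩
    · obtain ⟨K, hK, hc, hrest⟩ := h₂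
      exact ⟨K, hK, fun θ hθ => hc θ (hθ.resolve_left fun h' => h ⟨θ, h'⟩), hrest⟩
  · obtain ⟨⟨i₁, l₁, rel₁, r₁⟩, hK₁, hc₁, -, hl₁, hr₁⟩ := h₁
    obtain ⟨⟨i₂, l₂, rel₂, r₂⟩, hK₂, hc₂, -, hl₂, hr₂⟩ := h₂
    obtain rfl : rel₁ = .sub := rel_of_mem_Comega hK₁
    obtain rfl : rel₂ = .sub := rel_of_mem_Comega hK₂
    obtain rfl : e = l₁ := hl₁.eq
    obtain rfl : e = l₂ := hl₂.eq
    obtain rfl : r₁ = e' := hr₁.eq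
    obtain rfl : r₂ = r₁ := hr₂.eq
    have := mem_Comega_of_combine₃ hK₁ hK₂ ⟨rfl, Term.var, Term.var, isMGU_self_var _,
      isMGU_self_var _, rfl⟩
    simp only [Subst.comp_var, Cond.subst_var, Expr.subst_var] at this
    exact Derivable.of_mem this fun θ h => (hs.holds_iff _ _).2 (h.imp (hc₁ θ) (hc₂ θ))

/-- Disjunction over a non-empty finite family. -/
lemma Derivable.exists_or (hs : IsSimplify simplify) {ι : Type*} {e e' : Expr F Obj}
    {c : ι → Cond Obj} {s : Finset ι} (hne : s.Nonempty)
    (h : ∀ i ∈ s, Derivable simplify I (c i) e e') :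
    ∃ d, Derivable simplify I d e e' ∧ ∀ i ∈ s, ∀ θ, (c i).holds θ → d.holds θ := by
  classical
  induction hne using Finset.Nonempty.cons_induction with
  | singleton i => exact ⟨c i, h i (by simp), by simp⟩
  | cons i s hi hne ih =>
    obtain ⟨d, hd, hds⟩ := ih fun j hj => h j (by simp [hj])
    refine ⟨(c i).or d, (h i (by simp)).or hs hd, fun j hj θ hθ => ?_⟩
    rcases Finset.mem_cons.1 hj with rfl | hj
    · exact .inl hθ
    · exact .inr (hds j hj θ hθ)

/-! ### Paths of ground instances -/

/-- One ground instance of an invariant of `I` leads from `g` to `g'`. -/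
def Step (I : Set (Inv F Obj)) (g g' : F × List Obj) : Prop :=
  ∃ J ∈ I, ∃ τ : Assignment Obj, J.ic.holds τ ∧ J.lhs.ground τ = g ∧ J.rhs.ground τ = g'

/-- Entailment provides paths: the set of everything reachable from the left-hand side is a state
that satisfies `I`. -/
lemma reach_of_entails {inv : Inv F Obj} (hI : ∀ J ∈ I, J.rel = .sub) (hrel : inv.rel = .sub)
    (hent : Entails I inv) {θ : Assignment Obj} (hθ : inv.ic.holds θ) :
    Relation.ReflTransGen (Step I) (inv.lhs.ground θ) (inv.rhs.ground θ) := by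
  let S : State F Obj := {p | Relation.ReflTransGen (Step I) (inv.lhs.ground θ) (p.1, p.2.1)}
  have hS : ∀ K ∈ I, K.Sat S := by
    intro K hK τ hτ
    rw [hI K hK]
    exact fun o ho => Relation.ReflTransGen.tail ho ⟨K, hK, τ, hτ, rfl, rfl⟩
  have := hent S hS θ hθ
  rw [hrel] at this
  exact this (a := θ 0) (Relation.ReflTransGen.refl (a := inv.lhs.ground θ))

/-- A path is followed symbolically. The condition obtained holds under an assignment `η` that
extends `θ` (below the bound `M`), and contains no constants besides those in `T`. -/
lemma exists_derivable_of_reach (hs : IsSimplify simplify) (hI : ∀ J ∈ I, J.rel = .sub)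
    {T : List (Term Obj)} (hT : ∀ J ∈ I, ∀ t ∈ J.terms, t ∈ T) {e e' : Expr F Obj}
    (heT : ∀ t ∈ e.args, t ∈ T) (heT' : ∀ t ∈ e'.args, t ∈ T) {M : ℕ}
    (hM' : ∀ n, Term.var n ∈ e'.args → n < M) {θ : Assignment Obj}
    (hreach : Relation.ReflTransGen (Step I) (e.ground θ) (e'.ground θ)) :
    ∃ (c : Cond Obj) (η : Assignment Obj), Derivable simplify I c e e' ∧ c.holds η ∧
      (∀ n < M, η n = θ n) ∧ ∀ o, Term.const o ∈ c.terms → Term.const o ∈ T := by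
  have link {e₁ e₂ : Expr F Obj} {η : Assignment Obj} (h : e₁.ground η = e₂.ground η) :
      Derivable simplify I (eqCond e₁.args e₂.args) e₁ e₂ ∧
        (eqCond e₁.args e₂.args).holds η := by
    obtain ⟨f₁, l₁⟩ := e₁
    obtain ⟨f₂, l₂⟩ := e₂
    obtain ⟨rfl, hval⟩ : f₁ = f₂ ∧ l₁.map (Term.eval η) = l₂.map (Term.eval η) :=
      Prod.mk.inj h
    have hlen : l₁.length = l₂.length := by simpa using congrArg List.length hval
    exact ⟨derivable_eqCond f₁ hlen, (holds_eqCond hlen η).2 hval⟩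
  have main {g : F × List Obj} (hg : Relation.ReflTransGen (Step I) (e.ground θ) g) :
      ∃ (c : Cond Obj) (e₁ : Expr F Obj) (η : Assignment Obj),
        Derivable simplify I c e e₁ ∧ c.holds η ∧ e₁.ground η = g ∧ (∀ n < M, η n = θ n) ∧
        ∀ o, Term.const o ∈ c.terms ++ e₁.args → Term.const o ∈ T := by
    induction hg with
    | refl =>
      exact ⟨.tru, e, θ, derivable_refl e, trivial, rfl, fun _ _ => rfl,
        fun o ho => heT _ (by simpa [Cond.terms] using ho)⟩
    | tail _ hstep ih =>
      obtain ⟨c, e₁, η, hd, hc, hground, hη, hconst⟩ := ih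
      obtain ⟨J, hJ, τ, hτ, hl, rfl⟩ := hstep
      obtain ⟨N₀, hN₀⟩ := exists_var_bound (c.terms ++ e₁.args)
      -- The copy of `J` uses the variables from `N` on, which are fresh.
      set N := max N₀ M with hN
      have hvar : ∀ n, Term.var n ∈ c.terms ++ e₁.args → n < N := fun n hn =>
        lt_of_lt_of_le (hN₀ n hn) (le_max_left _ _)
      let η' : Assignment Obj := fun n => if n < N then η n else τ (n - N)
      have hlow : ∀ n < N, η' n = η n := fun n hn => if_pos hn
      have hhigh : ∀ n, η' (n + N) = τ n := fun n => by simp [η']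
      have hc' : c.holds η' :=
        Cond.holds_congr hlow (fun n hn => hvar n (List.mem_append_left _ hn)) hc
      have hJc : (J.ic.subst (shift N)).holds η' := (Cond.holds_subst_shift hhigh _).2 hτ
      obtain ⟨hlink, hlinkη⟩ :=
        link (e₁ := e₁) (e₂ := J.lhs.subst (shift N)) (η := η') (by
          rw [Expr.ground_subst_shift hhigh, hl, ← hground]
          exact Expr.ground_congr hlow fun n hn => hvar n (List.mem_append_right _ hn))
      refine ⟨_, _, η', (hd.trans hs hlink hI ⟨η', hc', hlinkη⟩).trans hs
        (derivable_shift hs hJ (hI J hJ) N) hI ⟨η', ⟨hc', hlinkη⟩, hJc⟩, ⟨⟨hc', hlinkη⟩, hJc⟩,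
        Expr.ground_subst_shift hhigh _, fun n hn => ?_, fun o ho => ?_⟩
      · rw [hlow n (lt_of_lt_of_le hn (le_max_right _ _)), hη n hn]
      · have hsub {l : List (Term Obj)} (hl : ∀ t ∈ l, t ∈ T)
            (h : Term.const o ∈ l.map (Term.subst (shift N))) : Term.const o ∈ T := by
          obtain ⟨t, ht, hto⟩ := List.mem_map.1 h
          cases t with
          | var n => simp [Term.subst, shift] at hto
          | const o' => exact hto ▸ hl _ ht
        have hJT := hT J hJ
        simp only [Inv.terms, List.mem_append] at hJT
        simp only [Cond.terms, Cond.terms_subst, Expr.subst, List.mem_append] at ho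
        rcases ho with ((ho | ho) | ho) | ho
        · exact hconst o (List.mem_append_left _ ho)
        · rcases mem_of_mem_terms_eqCond ho with ho | ho
          · exact hconst o (List.mem_append_right _ ho)
          · exact hsub (fun t ht => hJT t (.inl (.inr ht))) ho
        · exact hsub (fun t ht => hJT t (.inl (.inl ht))) ho
        · exact hsub (fun t ht => hJT t (.inr ht)) ho
  obtain ⟨c, e₁, η, hd, hc, hground, hη, hconst⟩ := main hreach
  obtain ⟨hlink, hlinkη⟩ := link (hground.trans (Expr.ground_congr hη hM').symm)
  refine ⟨_, η, hd.trans hs hlink hI ⟨η, hc, hlinkη⟩, ⟨hc, hlinkη⟩, hη, fun o ho => ?_⟩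
  rcases List.mem_append.1 ho with ho | ho
  · exact hconst o (List.mem_append_left _ ho)
  · rcases mem_of_mem_terms_eqCond ho with ho | ho
    · exact hconst o (List.mem_append_right _ ho)
    · exact heT' _ ho

end Derivable

/-! ### Subwords -/

/-- Higman's lemma over a finite alphabet, in the form of a finite basis: finitely many members of a
family of words are enough to have a subword of every member. -/
lemma exists_finset_sublist {α A : Type*} [Finite A] (w : α → List A) :
    ∃ s : Finset α, ∀ y, ∃ x ∈ s, (w x).Sublist (w y) := by
  by_contra! hcon
  obtain ⟨f, -, hf⟩ := exists_seq_of_forall_finset_exists (fun _ => True)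
    (fun x y => ¬ (w x).Sublist (w y)) fun s _ => (hcon s).imp fun _ hy => ⟨trivial, hy⟩
  have hA : (Set.univ : Set A).PartiallyWellOrderedOn Eq :=
    Set.finite_univ.partiallyWellOrderedOn
  obtain ⟨m, n, hmn, h⟩ :=
    (Set.PartiallyWellOrderedOn.partiallyWellOrderedOn_sublistForall₂ Eq hA).exists_lt
      (f := fun n => w (f n)) fun _ _ _ => trivial
  refine hf m n hmn ?_
  obtain ⟨l, hl, hsub⟩ := List.sublistForall₂_iff.1 h
  rw [List.forall₂_eq_eq_eq] at hl
  exact hl ▸ hsub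

/-- A subword relation between the label sequences of two increasing lists comes from a strictly
monotone map that preserves labels. -/
lemma exists_strictMonoOn_of_sublist {Obj A : Type*} [LinearOrder Obj] {l l' : List Obj}
    (hl : l.Pairwise (· < ·)) (hl' : l'.Pairwise (· < ·)) {f f' : Obj → A}
    (hsub : (l.map f).Sublist (l'.map f')) :
    ∃ h : Obj → Obj, StrictMonoOn h {x | x ∈ l} ∧ ∀ x ∈ l, f' (h x) = f x := by
  obtain ⟨k, hk, hmap⟩ := List.sublist_map_iff.1 hsub
  replace hl' := hl'.sublist hk
  suffices ∃ h : Obj → Obj, StrictMonoOn h {x | x ∈ l} ∧ ∀ x ∈ l, f' (h x) = f x ∧ h x ∈ k from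
    this.imp fun h hh => ⟨hh.1, fun x hx => (hh.2 x hx).1⟩
  clear hsub hk l'
  induction l generalizing k with
  | nil => exact ⟨id, by simp [StrictMonoOn], by simp⟩
  | cons a l ih =>
    cases k with
    | nil => simp at hmap
    | cons b k =>
      simp only [List.map_cons, List.cons.injEq] at hmap
      rw [List.pairwise_cons] at hl hl'
      obtain ⟨h, hmono, hh⟩ := ih hl.2 k hmap.2 hl'.2
      have hne : ∀ x ∈ l, x ≠ a := fun x hx => (hl.1 x hx).ne'
      have hup : ∀ x ∈ l, Function.update h a b x = h x := fun x hx =>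
        Function.update_of_ne (hne x hx) _ _
      refine ⟨Function.update h a b, ?_, ?_⟩
      · intro x hx y hy hxy
        rcases List.mem_cons.1 hx with rfl | hx' <;> rcases List.mem_cons.1 hy with rfl | hy'
        · exact absurd hxy (lt_irrefl _)
        · rw [hup y hy', Function.update_self]
          exact hl'.1 _ (hh y hy').2
        · exact absurd hxy (lt_asymm (hl.1 _ hx'))
        · rw [hup x hx', hup y hy']
          exact hmono hx' hy' hxy
      · intro x hx
        rcases List.mem_cons.1 hx with rfl | hx
        · simp [hmap.1]
        · rw [hup x hx]
          exact ⟨(hh x hx).1, List.mem_cons_of_mem _ (hh x hx).2⟩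

end CodeInv

/-! ### Completeness -/

open CodeInv in
theorem theorem7 {F : Type*} {Obj : Type*} [LinearOrder Obj] [Nonempty Obj]
    (simplify : CodeInv.Cond Obj → CodeInv.Cond Obj) (hsimplify : CodeInv.IsSimplify simplify)
    (I : Set (CodeInv.Inv F Obj)) (hfin : I.Finite)
    (hI : ∀ J ∈ I, J.WellFormed ∧ J ∈ CodeInv.SubInv F Obj)
    (inv : CodeInv.Inv F Obj) (hinv : inv.WellFormed ∧ inv ∈ CodeInv.SubInv F Obj)
    (hent : CodeInv.Entails I inv) :
    ∃ inv' ∈ CodeInv.Comega simplify (CodeInv.SubInv F Obj) I,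
      CodeInv.Entails {inv'} inv := by
  have hI' : ∀ J ∈ I, J.rel = .sub := fun J hJ => (hI J hJ).2
  have hrel : inv.rel = .sub := hinv.2
  by_cases hcons : ∃ θ, inv.ic.holds θ
  swap
  · -- An invariant with an inconsistent condition is itself a tautology.
    exact ⟨inv, mem_Comega_of_taut ⟨hinv.1, fun S θ hθ => absurd ⟨θ, hθ⟩ hcons⟩ hrel,
      fun S hS => hS inv rfl⟩
  obtain ⟨M, hM⟩ := exists_var_bound inv.terms
  -- The terms used as labels: the variables of `inv` and all constants in sight.
  let T : List (Term Obj) :=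
    (List.range M).map Term.var ++ hfin.toFinset.toList.flatMap Inv.terms ++ inv.terms
  have hTI : ∀ J ∈ I, ∀ t ∈ J.terms, t ∈ T := fun J hJ t ht =>
    List.mem_append_left _ (List.mem_append_right _
      (List.mem_flatMap.2 ⟨J, by simpa using hJ, ht⟩))
  have hTinv : ∀ t ∈ inv.terms, t ∈ T := fun t ht => List.mem_append_right _ ht
  have hTvar : ∀ n < M, Term.var n ∈ T := fun n hn => by simp [T, hn]
  have hl : ∀ t ∈ inv.lhs.args, t ∈ inv.terms := fun t ht => by simp [Inv.terms, ht]
  have hr : ∀ t ∈ inv.rhs.args, t ∈ inv.terms := fun t ht => by simp [Inv.terms, ht]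
  have hpath (θ : {θ // inv.ic.holds θ}) :=
    exists_derivable_of_reach hsimplify hI' hTI (fun t ht => hTinv t (hl t ht))
      (fun t ht => hTinv t (hr t ht)) (fun n hn => hM n (hr _ hn))
      (reach_of_entails hI' hrel hent θ.2)
  choose c η hder hcη hηθ hconst using hpath
  let E (θ : {θ // inv.ic.holds θ}) : List Obj :=
    ((c θ).terms.map (Term.eval (η θ)) ++ T.map (Term.eval θ.1)).toFinset.sort (· ≤ ·)
  let label (θ : {θ // inv.ic.holds θ}) (x : Obj) : Set {t // t ∈ T} := {t | t.1.eval θ.1 = x}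
  have hEsorted (θ) : (E θ).Pairwise (· < ·) := Finset.sortedLT_sort _ |>.pairwise
  have : Finite {t // t ∈ T} := List.finite_toSet T
  obtain ⟨s, hs⟩ := exists_finset_sublist fun θ => (E θ).map (label θ)
  have hsne : s.Nonempty := by
    obtain ⟨θ, hθ⟩ := hcons
    obtain ⟨x, hx, -⟩ := hs ⟨θ, hθ⟩
    exact ⟨x, hx⟩
  obtain ⟨d, ⟨K, hK, hdK, -, hKl, hKr⟩, hd⟩ :=
    Derivable.exists_or hsimplify hsne fun θ _ => hder θ
  refine ⟨K, hK, fun S hS θ' hθ' => ?_⟩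
  obtain ⟨θ, hθs, hsub⟩ := hs ⟨θ', hθ'⟩
  obtain ⟨h, hmono, hlabel⟩ := exists_strictMonoOn_of_sublist (hEsorted θ) (hEsorted _) hsub
  have hET : ∀ t ∈ T, h (t.eval θ.1) = t.eval θ' := fun t ht => by
    have hmem : t.eval θ.1 ∈ E θ := by
      simp only [E, Finset.mem_sort, List.mem_toFinset, List.mem_append]
      exact .inr (List.mem_map_of_mem ht)
    have : (⟨t, ht⟩ : {t // t ∈ T}) ∈ label θ (t.eval θ.1) := rfl
    rw [← hlabel _ hmem] at this
    exact this.symm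
  let η' : Assignment Obj := fun n => if n < M then θ' n else h (η θ n)
  have hη' : ∀ n < M, η' n = θ' n := fun n hn => if_pos hn
  have hholds : (c θ).holds η' := by
    refine Cond.holds_of_strictMonoOn hmono (fun t ht => ?_) (fun t ht => ?_) (hcη θ)
    · simp only [E, Set.mem_ofPred_eq, Finset.mem_sort, List.mem_toFinset, List.mem_append]
      exact .inl (List.mem_map_of_mem ht)
    · cases t with
      | const o => exact (hET _ (hconst θ o ht)).symm
      | var n =>
        by_cases hn : n < M
        · simp only [Term.eval, hη' n hn, hηθ θ n hn]
          exact (hET _ (hTvar n hn)).symm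
        · simp [Term.eval, η', hn]
  have hsat := hS K rfl η' (hdK _ (hd θ hθs _ hholds))
  rw [rel_of_mem_Comega hK] at hsat
  have hincl := ((hKl S η').trans hsat).trans (hKr S η')
  have hargs {e : Expr F Obj} (he : ∀ t ∈ e.args, t ∈ inv.terms) :
      e.denot S η' = e.denot S θ' := by
    have := congrArg Prod.snd (Expr.ground_congr hη' fun n hn => hM n (he _ hn))
    simp only [Expr.ground] at this
    simp only [Expr.denot, this]
  rw [hrel]
  rwa [hargs hl, hargs hr] at hincl
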